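/- **Setting.** Let $\mathbb F$ be a finite field and $n$ a positive integer coprime to $|\mathbb F|$. Let $A=\mathbb F[x]/\langle x^n-1\rangle$ and write $x^n-1=\pi_1\cdots\pi_r$ with pairwise different monic irreducible polynomials $\pi_k\in\mathbb F[x]$, ordered by nondecreasing degree. Let $\varepsilon_1,\dots,\varepsilon_r\in A$ be the primitive idempotents, i.e. the preimages of the standard unit vectors under the Chinese remainder isomorphism $A\cong\prod_{k=1}^r\mathbb F[x]/\langle\pi_k\rangle$. Fix an $\mathbb F$-algebra automorphism $\sigma$ of $A$ and let $A[z;\sigma]$ be the skew polynomial ring whose elements are the polynomials $\sum_j z^ja_j$ ($a_j\in A$), with coefficientwise addition and with multiplication determined by $az=z\sigma(a)$ for $a\in A$. **Reduced polynomials.** For $f=\sum_\nu z^\nu f_\nu\in A[z;\sigma]$ put $f^{(k)}:=\varepsilon_kf$; $f$ is called a component if $f=f^{(k)}$ for some $k$. The terms of $f$ are the elements $z^\nu\varepsilon_lf_\nu$, and for $f\neq0$ the leading monomial of $f$ is the largest $z^\mu\varepsilon_k$ with $\varepsilon_kf_\mu\ne0$, where $z^\nu\varepsilon_l<z^\mu\varepsilon_k$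 iff $\nu<\mu$, or $\nu=\mu$ and $l<k$. The polynomial $f$ is reduced if for all $k\neq l$ with $f^{(l)}\ne 0$ no nonzero term of $f^{(k)}$ is right divisible by the leading monomial $m$ of $f^{(l)}$, i.e. is of the form $hm$ with $h\in A[z;\sigma]$. **Codes.** A convolutional code of length $n$ is a submodule $\{uG\mid u\in\mathbb F[z]^k\}$ of $\mathbb F[z]^n$ with $G\in\mathbb F[z]^{k\times n}$ right invertible; equivalently, a direct summand of $\mathbb F[z]^n$. Let $\mathfrak p:\mathbb F[z]^n\to A[z;\sigma]$ be given by $\sum_jz^j(v_{j,0},\dots,v_{j,n-1})\mapsto\sum_jz^j\sum_{i=0}^{n-1}v_{j,i}x^i$. A convolutional code $\mathcal C$ is $\sigma$-cyclic if $\mathfrak p(\mathcal C)$ is a left ideal of $A[z;\sigma]$. A generator polynomial of $\mathcal C$ is a reduced polynomial $g$ with $\mathfrak p(\mathcal C)=\{fg\mid f\in A[z;\sigma]\}$. **Proposition.** Let $\mathcal C\subseteq\mathbb F[z]^n$ be a $\sigma$-cyclic convolutional code with generator polynomial $g\in A[z;\sigma]$. The following are equivalent. (i) $\mathcal C$ is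 minimal, that is, $\mathcal C\neq\{0\}$ and $g$ is a component: $g=g^{(l)}$ for some $l\in\{1,\dots,r\}$. (ii) $\mathcal C\neq\{0\}$ and $\mathcal C$ contains no proper nonzero $\sigma$-cyclic subcode: if $\hat{\mathcal C}$ is a $\sigma$-cyclic convolutional code with $\{0\}\neq\hat{\mathcal C}\subseteq\mathcal C$, then $\hat{\mathcal C}=\mathcal C$. (iii) There exist a unit $u\in A[z;\sigma]$ and an index $l\in\{1,\dots,r\}$ such that $g=u^{(l)}$. -/

import Mathlib

open Polynomial

noncomputable section

namespace CyclicConv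

/-! ### The skew polynomial ring `A[z;σ]` -/

section Piret

/-- The set `A[z]` of polynomials `∑ z^j a_j` with right coefficients `a_j ∈ A`, stored as the
finitely supported function `j ↦ a_j`. The multiplication depends on `σ` and is given below. -/
def PiretAlgebra {F A : Type*} [CommRing F] [CommRing A] [Algebra F A] (_σ : A ≃ₐ[F] A) : Type _ :=
  ℕ →₀ A

variable {F A : Type*} [CommRing F] [CommRing A] [Algebra F A] (σ : A ≃ₐ[F] A)

namespace PiretAlgebra

/-- Addition is coefficientwise. -/
instance : AddCommGroup (PiretAlgebra σ) := inferInstanceAs (AddCommGroup (ℕ →₀ A))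

/-- The polynomial `z^j a`, additively in `a`. -/
def monomial (j : ℕ) : A →+ PiretAlgebra σ := Finsupp.singleAddHom j

variable {σ} in
/-- The right coefficient `f_j` of `z^j` in `f = ∑ z^j f_j`. -/
def coeff (f : PiretAlgebra σ) (j : ℕ) : A := (show ℕ →₀ A from f) j

/-- `(∑ z^j a_j) (∑ z^l b_l) = ∑_{j,l} z^{j+l} σ^l(a_j) b_l`. -/
instance : Mul (PiretAlgebra σ) where
  mul f g := Finsupp.sum (show ℕ →₀ A from f) fun j a =>
    Finsupp.sum (show ℕ →₀ A from g) fun l b => monomial σ (j + l) ((σ ^ l) a * b)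

instance : One (PiretAlgebra σ) := ⟨monomial σ 0 1⟩

variable {σ}

theorem induction_on {P : PiretAlgebra σ → Prop} (f : PiretAlgebra σ) (h0 : P 0)
    (hadd : ∀ f g, P f → P g → P (f + g)) (hm : ∀ j a, P (monomial σ j a)) : P f :=
  Finsupp.induction_linear (motive := P) f h0 hadd hm

theorem zero_mul' (f : PiretAlgebra σ) : 0 * f = 0 := Finsupp.sum_zero_index

theorem mul_zero' (f : PiretAlgebra σ) : f * 0 = 0 :=
  Finset.sum_eq_zero fun _ _ => Finsupp.sum_zero_index

theorem add_mul' (f g h : PiretAlgebra σ) : (f + g) * h = f * h + g * h := by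
  refine Finsupp.sum_add_index' (fun j => ?_) (fun j a b => ?_)
  · exact Finset.sum_eq_zero fun l _ => by simp
  · simp only [map_add, add_mul]
    exact Finsupp.sum_add

theorem mul_add' (f g h : PiretAlgebra σ) : f * (g + h) = f * g + f * h := by
  refine Eq.trans (Finset.sum_congr rfl fun j _ => ?_) Finsupp.sum_add
  exact Finsupp.sum_add_index' (fun l => by simp) (fun l a b => by simp [mul_add])

theorem monomial_mul_monomial (j l : ℕ) (a b : A) :
    monomial σ j a * monomial σ l b = monomial σ (j + l) ((σ ^ l) a * b) := by
  refine (Finsupp.sum_single_index ?_).trans (Finsupp.sum_single_index ?_)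
  · exact Finset.sum_eq_zero fun l _ => by simp
  · simp

theorem one_def : (1 : PiretAlgebra σ) = monomial σ 0 1 := rfl

instance : Ring (PiretAlgebra σ) where
  __ := (inferInstance : AddCommGroup (PiretAlgebra σ))
  zero_mul := zero_mul'
  mul_zero := mul_zero'
  left_distrib := mul_add'
  right_distrib := add_mul'
  mul_assoc f g h := by
    induction f using induction_on with
    | h0 => simp only [zero_mul']
    | hadd f₁ f₂ h₁ h₂ => simp only [add_mul', h₁, h₂]
    | hm i a =>
      induction g using induction_on with
      | h0 => simp only [zero_mul', mul_zero']
      | hadd f₁ f₂ h₁ h₂ => simp only [add_mul', mul_add', h₁, h₂]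
      | hm j b =>
        induction h using induction_on with
        | h0 => simp only [mul_zero']
        | hadd f₁ f₂ h₁ h₂ => simp only [mul_add', h₁, h₂]
        | hm k c =>
          simp only [monomial_mul_monomial, map_mul, add_assoc, mul_assoc]
          rw [← AlgEquiv.mul_apply, ← pow_add, add_comm k j]
  one_mul f := by
    induction f using induction_on with
    | h0 => exact mul_zero' _
    | hadd f₁ f₂ h₁ h₂ => rw [mul_add', h₁, h₂]
    | hm i a => rw [one_def, monomial_mul_monomial]; simp
  mul_one f := by
    induction f using induction_on with
    | h0 => exact zero_mul' _
    | hadd f₁ f₂ h₁ h₂ => rw [add_mul', h₁, h₂]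
    | hm i a => rw [one_def, monomial_mul_monomial]; simp

/-- The defining formula: the coefficient of `z^t` in `f g` is `∑_{j+l=t} σ^l(f_j) g_l`. -/
theorem coeff_mul (f g : PiretAlgebra σ) (t : ℕ) :
    (f * g).coeff t = ∑ x ∈ Finset.HasAntidiagonal.antidiagonal t, (σ ^ x.2) (f.coeff x.1) * g.coeff x.2 := by
  have hadd : ∀ (f g : PiretAlgebra σ) j, (f + g).coeff j = f.coeff j + g.coeff j :=
    fun _ _ _ => rfl
  have hz : ∀ j, (0 : PiretAlgebra σ).coeff j = 0 := fun _ => rfl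
  have hm : ∀ i j a, (monomial σ i a).coeff j = if i = j then a else 0 :=
    fun _ _ _ => Finsupp.single_apply
  induction f using induction_on with
  | h0 => simp [hz]
  | hadd f₁ f₂ h₁ h₂ => simp [add_mul, hadd, h₁, h₂, Finset.sum_add_distrib]
  | hm i a =>
    induction g using induction_on with
    | h0 => simp [hz]
    | hadd f₁ f₂ h₁ h₂ => simp [mul_add, hadd, h₁, h₂, Finset.sum_add_distrib]
    | hm j b =>
      rw [monomial_mul_monomial, hm]
      simp only [hm]
      split_ifs with h
      · rw [Finset.sum_eq_single (i, j)]
        · simp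
        · rintro ⟨p, q⟩ _ hne
          by_cases hp : i = p
          · have : j ≠ q := fun hq => hne (by rw [hp, hq])
            simp [this]
          · simp [hp]
        · intro hn; exact absurd (Finset.HasAntidiagonal.mem_antidiagonal.2 h) hn
      · refine (Finset.sum_eq_zero ?_).symm
        rintro ⟨p, q⟩ hpq
        rw [Finset.HasAntidiagonal.mem_antidiagonal] at hpq
        by_cases hp : i = p
        · have : j ≠ q := fun hq => h (by rw [hp, hq]; exact hpq)
          simp [this]
        · simp [hp]

end PiretAlgebra

end Piret

/-! ### The algebra `A = F[x]/(x^n - 1)` and its primitive idempotents -/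

/-- `A = F[x]/(x^n - 1)`. -/
abbrev CyclicAlg (F : Type*) [Field F] (n : ℕ) : Type _ := AdjoinRoot (X ^ n - 1 : F[X])

/-- A factorization `x^n - 1 = π_1 ⋯ π_r` into pairwise different monic irreducible polynomials,
listed by nondecreasing degree. -/
structure OrderedFactorization (F : Type*) [Field F] (n r : ℕ) where
  factor : Fin r → F[X]
  monic : ∀ k, (factor k).Monic
  irreducible : ∀ k, Irreducible (factor k)
  injective : Function.Injective factor
  prod_eq : ∏ k, factor k = X ^ n - 1
  degree_mono : Monotone fun k => (factor k).natDegree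

section Code

variable {F : Type*} [Field F] {n r : ℕ}

namespace OrderedFactorization

variable (π : OrderedFactorization F n r)

theorem factor_dvd (k : Fin r) : π.factor k ∣ X ^ n - 1 :=
  π.prod_eq ▸ Finset.dvd_prod_of_mem _ (Finset.mem_univ k)

/-- The canonical projection `ρ_k : A → K_k = F[x]/(π_k)`. -/
def proj (k : Fin r) : CyclicAlg F n →+* AdjoinRoot (π.factor k) :=
  Ideal.Quotient.factor (Ideal.span_singleton_le_span_singleton.2 (π.factor_dvd k))

theorem isCoprime {k l : Fin r} (h : k ≠ l) : IsCoprime (π.factor k) (π.factor l) := by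
  refine ((π.irreducible k).coprime_iff_not_dvd).2 fun hd => h (π.injective ?_)
  exact eq_of_monic_of_associated (π.monic k) (π.monic l)
    ((π.irreducible k).associated_of_dvd (π.irreducible l) hd)

theorem pi_proj_bijective : Function.Bijective (RingHom.pi π.proj) := by
  constructor
  · rw [injective_iff_map_eq_zero]
    intro a ha
    obtain ⟨f, rfl⟩ := AdjoinRoot.mk_surjective a
    rw [AdjoinRoot.mk_eq_zero, ← π.prod_eq]
    refine Finset.prod_dvd_of_coprime (fun k _ l _ h => π.isCoprime h) fun k _ => ?_
    exact AdjoinRoot.mk_eq_zero.1 (congrFun ha k)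
  · intro b
    choose f hf using fun k => AdjoinRoot.mk_surjective (b k)
    have hc : Pairwise fun k l => IsCoprime (Ideal.span {π.factor k}) (Ideal.span {π.factor l}) :=
      fun k l h => (Ideal.isCoprime_span_singleton_iff _ _).2 (π.isCoprime h)
    obtain ⟨y, hy⟩ := Ideal.exists_forall_sub_mem_ideal hc f
    refine ⟨AdjoinRoot.mk _ y, funext fun k => ?_⟩
    rw [← hf k]
    exact Ideal.Quotient.eq.2 (hy k)

/-- The Chinese remainder isomorphism `ψ : A ≅ K_1 × ⋯ × K_r`. -/
def crt : CyclicAlg F n ≃+* ((k : Fin r) → AdjoinRoot (π.factor k)) :=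
  RingEquiv.ofBijective (RingHom.pi π.proj) π.pi_proj_bijective

/-- The primitive idempotent `ε_k = ψ⁻¹(0, …, 0, 1, 0, …, 0)`. -/
def idem (k : Fin r) : CyclicAlg F n := π.crt.symm (Pi.single k 1)

end OrderedFactorization

/-! ### Components, leading monomials, reduced polynomials -/

variable (π : OrderedFactorization F n r) {σ : CyclicAlg F n ≃ₐ[F] CyclicAlg F n}

/-- The `k`-th component `f^{(k)} = ε_k f`. -/
def component (k : Fin r) (f : PiretAlgebra σ) : PiretAlgebra σ :=
  PiretAlgebra.monomial σ 0 (π.idem k) * f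

/-- `f` is a component if `f = f^{(k)}` for some `k`. -/
def IsComponent (f : PiretAlgebra σ) : Prop := ∃ k, f = component π k f

/-- The term `z^ν ε_l f_ν` of `f`. -/
def term (f : PiretAlgebra σ) (ν : ℕ) (l : Fin r) : PiretAlgebra σ :=
  PiretAlgebra.monomial σ ν (π.idem l * f.coeff ν)

/-- `z^μ ε_k` is the leading monomial of `f`, for the order in which `z^ν ε_l < z^μ ε_k` iff
`ν < μ`, or `ν = μ` and `l < k`. The zero polynomial has no leading monomial. -/
def IsLeadingMonomial (f : PiretAlgebra σ) (μ : ℕ) (k : Fin r) : Prop :=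
  π.idem k * f.coeff μ ≠ 0 ∧
    ∀ (ν : ℕ) (l : Fin r), π.idem l * f.coeff ν ≠ 0 → ν < μ ∨ (ν = μ ∧ l ≤ k)

/-- `f` is (left) reduced: for `k ≠ l` no nonzero term of `f^{(k)}` is right divisible by the
leading monomial of `f^{(l)}`. -/
def IsReduced (f : PiretAlgebra σ) : Prop :=
  ∀ k l : Fin r, k ≠ l → ∀ (μ : ℕ) (m : Fin r), IsLeadingMonomial π (component π l f) μ m →
    ∀ (ν : ℕ) (q : Fin r), term π (component π k f) ν q ≠ 0 →
      ¬ ∃ h : PiretAlgebra σ,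
        term π (component π k f) ν q = h * PiretAlgebra.monomial σ μ (π.idem m)

/-! ### Convolutional codes -/

/-- A convolutional code of length `n`: the row space `{u G}` of a right invertible polynomial
matrix `G`. -/
def IsConvolutionalCode (C : Submodule F[X] (Fin n → F[X])) : Prop :=
  ∃ (k : ℕ) (G : Matrix (Fin k) (Fin n) F[X]),
    (∃ G' : Matrix (Fin n) (Fin k) F[X], G * G' = 1) ∧ C = LinearMap.range G.vecMulLinear

/-- The convolutional codes are the direct summands of `F[z]^n`. -/
theorem isConvolutionalCode_iff_isComplemented (C : Submodule F[X] (Fin n → F[X])) :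
    IsConvolutionalCode C ↔ IsComplemented C := by
  constructor
  · rintro ⟨k, G, ⟨G', hG⟩, rfl⟩
    have h : ∀ x, (G.vecMulLinear ∘ₗ G'.vecMulLinear) x ∈ LinearMap.range G.vecMulLinear :=
      fun x => ⟨_, rfl⟩
    refine ⟨_, LinearMap.isCompl_of_proj
      (f := (G.vecMulLinear ∘ₗ G'.vecMulLinear).codRestrict _ h) ?_⟩
    rintro ⟨_, u, rfl⟩
    apply Subtype.ext
    simp [Matrix.vecMul_vecMul, hG]
  · rintro ⟨D, hD⟩
    obtain ⟨k, b⟩ := Submodule.basisOfPid (Pi.basisFun F[X] (Fin n)) C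
    let f := C.projectionOnto D hD
    refine ⟨k, Matrix.of fun i => (b i : Fin n → F[X]),
      ⟨Matrix.of fun j i => b.repr (f (Pi.single j 1)) i, ?_⟩, ?_⟩
    · ext i i'
      have h1 : f (b i : Fin n → F[X]) = b i := Submodule.projectionOnto_apply_left hD (b i)
      have h2 : (b i : Fin n → F[X]) = ∑ j, (b i : Fin n → F[X]) j • Pi.single j (1 : F[X]) :=
        pi_eq_sum_univ' _
      have h3 : b.repr (f (b i : Fin n → F[X])) i' =
          ∑ j, (b i : Fin n → F[X]) j * b.repr (f (Pi.single j 1)) i' := by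
        conv_lhs => rw [h2]
        simp [Finsupp.finsetSum_apply]
      rw [Matrix.mul_apply, Matrix.one_apply]
      simp only [Matrix.of_apply]
      rw [← h3, h1, b.repr_self, Finsupp.single_apply]
    · ext v
      rw [LinearMap.mem_range]
      constructor
      · intro hv
        refine ⟨b.equivFun ⟨v, hv⟩, ?_⟩
        have := congrArg Subtype.val (b.sum_equivFun ⟨v, hv⟩)
        rw [Matrix.vecMulLinear_apply, Matrix.vecMul_eq_sum]
        rw [Submodule.coe_sum] at this
        exact this
      · rintro ⟨u, rfl⟩
        rw [Matrix.vecMulLinear_apply, Matrix.vecMul_eq_sum]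
        exact C.sum_mem fun i _ => C.smul_mem _ (b i).2

/-- The map `𝔭 : F[z]^n → A[z;σ]`, coefficientwise
`(v_0, …, v_{n-1}) ↦ v_0 + v_1 x + ⋯ + v_{n-1} x^{n-1}`. -/
def toPiret (σ : CyclicAlg F n ≃ₐ[F] CyclicAlg F n) (v : Fin n → F[X]) : PiretAlgebra σ :=
  ∑ i : Fin n, (v i).sum fun j c =>
    PiretAlgebra.monomial σ j (c • AdjoinRoot.root (X ^ n - 1 : F[X]) ^ (i : ℕ))

/-- A submodule of `F[z]^n` is `σ`-cyclic if its image in `A[z;σ]` is a left ideal. -/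
def IsSigmaCyclic (σ : CyclicAlg F n ≃ₐ[F] CyclicAlg F n)
    (S : Submodule F[X] (Fin n → F[X])) : Prop :=
  ∃ I : Ideal (PiretAlgebra σ), (I : Set (PiretAlgebra σ)) = toPiret σ '' (S : Set (Fin n → F[X]))

/-- A `σ`-cyclic convolutional code. -/
def IsSigmaCyclicCode (σ : CyclicAlg F n ≃ₐ[F] CyclicAlg F n)
    (C : Submodule F[X] (Fin n → F[X])) : Prop :=
  IsConvolutionalCode C ∧ IsSigmaCyclic σ C

/-- `g` is a generator polynomial of `C`: it is reduced and generates the left ideal `𝔭(C)`. -/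
def IsGeneratorPolynomial (C : Submodule F[X] (Fin n → F[X])) (g : PiretAlgebra σ) : Prop :=
  IsReduced π g ∧
    ((Ideal.span {g} : Ideal (PiretAlgebra σ)) : Set (PiretAlgebra σ)) =
      toPiret σ '' (C : Set (Fin n → F[X]))

/-- The code `C` with generator polynomial `g` is minimal: it is nonzero and `g` is a
component. -/
def IsMinimalCode (C : Submodule F[X] (Fin n → F[X])) (g : PiretAlgebra σ) : Prop :=
  C ≠ ⊥ ∧ IsComponent π g

end Code

end CyclicConv

end

/-! Each field idempotent `e` of `A` (one for which `e A` is a field) that is moved by a power of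
`σ` lands on another such idempotent. Hence every coefficient of a component `g^(l)` at a given
degree lies in one field `ε_m A`, and leading coefficients of products through `ε_l` do not cancel:
degrees add, although `A` has zero divisors (`coeff_mul_top_ne_zero`).

Two facts carry the equivalences. Column reduction (`exists_unit_mul_eq`): a nonzero component can
be moved into some `A[z;σ] ε_m` by right multiplication with a unit. Rank one
(`exists_sub_mul_eq_mul`): inside `A[z;σ] ε_m`, division with remainder by a nonzero `h` leaves
finitely many remainders, so among the `z^i x` two agree and `(z^j - z^i) x` is a left multiple of
`h`. Codes are direct summands over `F[z]`, hence saturated, so such factors `z^j - z^i` can be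
cancelled.

A component therefore generates a code without proper subcodes. Conversely, suppose that `g` has two
nonzero components, and let a unit `v` move `g^(l)` into `A[z;σ] ε_m`. The elements that `v` moves
there form a subcode containing `g^(l)`; if it is all of `C`, then `g^(k) v` lies there too, and
rank one gives a relation `(z^j - z^i) g^(k) = q g^(l)`, which comparison of leading terms excludes
for reduced `g`. Finally, if `g` is a component, saturation gives `f g v = ε_k`, so `g v` has degree
zero and is a component of a constant unit. -/

noncomputable section

namespace CyclicConv

/-! ### Idempotents that cut out a field -/

/-- An idempotent `e` for which the ring `e A` is a field. -/
structure IsFieldIdempotent {A : Type*} [CommRing A] (e : A) : Prop where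
  ne_zero : e ≠ 0
  mul_self : e * e = e
  exists_mul_eq : ∀ a, e * a ≠ 0 → ∃ b, b * (e * a) = e

namespace IsFieldIdempotent

variable {A : Type*} [CommRing A] {e f : A}

theorem mul_ne_zero (he : IsFieldIdempotent e) {a b : A} (ha : e * a ≠ 0) (hb : e * b ≠ 0) :
    e * a * b ≠ 0 := by
  intro h
  obtain ⟨c, hc⟩ := he.exists_mul_eq a ha
  exact hb (by rw [← hc, mul_assoc, h, mul_zero])

/-- In the field `e A` the idempotent `e * f` can only be `0` or the identity `e`. Used in both
orders, this shows that distinct field idempotents are orthogonal. -/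
theorem mul_eq_left (he : IsFieldIdempotent e) (hf : f * f = f) (h : e * f ≠ 0) :
    e * f = e := by
  obtain ⟨b, hb⟩ := he.exists_mul_eq f h
  calc e * f = b * (e * (f * f)) := by rw [← mul_assoc e, ← mul_assoc, hb]
    _ = e := by rw [hf, hb]

theorem map {B : Type*} [CommRing B] (he : IsFieldIdempotent e) (φ : A ≃+* B) : IsFieldIdempotent (φ e) where
  ne_zero := by simpa using he.ne_zero
  mul_self := by rw [← map_mul, he.mul_self]
  exists_mul_eq a ha := by
    obtain ⟨b, hb⟩ := he.exists_mul_eq (φ.symm a) (by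
      intro h
      apply ha
      simpa using congrArg φ h)
    exact ⟨φ b, by simpa using congrArg φ hb⟩

theorem pi_single {ι : Type*} [DecidableEq ι] {K : ι → Type*} [∀ k, CommRing (K k)] {k : ι}
    (hK : IsField (K k)) : IsFieldIdempotent (Pi.single k 1 : (k : ι) → K k) where
  ne_zero := by
    have := hK.nontrivial
    exact Pi.single_ne_zero_iff.2 one_ne_zero
  mul_self := by rw [← Pi.single_mul, one_mul]
  exists_mul_eq a ha := by
    rw [← Pi.single_mul_left, one_mul] at ha ⊢
    obtain ⟨b, hb⟩ := hK.mul_inv_cancel (Pi.single_ne_zero_iff.1 ha)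
    exact ⟨Pi.single k b, by rw [← Pi.single_mul, mul_comm, hb]⟩

theorem eq_of_mul_ne_zero (he : IsFieldIdempotent e) (hf : IsFieldIdempotent f)
    (h : e * f ≠ 0) : e = f := by
  rw [← he.mul_eq_left hf.mul_self h, mul_comm]
  exact hf.mul_eq_left he.mul_self (by rwa [mul_comm])

end IsFieldIdempotent

theorem _root_.CompleteOrthogonalIdempotents.exists_mul_ne_zero {A ι : Type*} [Semiring A]
    [Fintype ι] {e : ι → A} (he : CompleteOrthogonalIdempotents e) {a : A} (ha : a ≠ 0) :
    ∃ i, e i * a ≠ 0 := by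
  by_contra! h
  apply ha
  rw [← one_mul a, ← he.complete, Finset.sum_mul]
  exact Finset.sum_eq_zero fun i _ => h i

/-! ### Coefficients and degrees in the skew polynomial ring -/

namespace PiretAlgebra

variable {F A : Type*} [CommRing F] [CommRing A] [Algebra F A] {σ : A ≃ₐ[F] A}

@[ext]
theorem ext {f g : PiretAlgebra σ} (h : ∀ t, f.coeff t = g.coeff t) : f = g :=
  Finsupp.ext h

@[simp] theorem coeff_zero (t : ℕ) : (0 : PiretAlgebra σ).coeff t = 0 := rfl

@[simp] theorem coeff_add (f g : PiretAlgebra σ) (t : ℕ) :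
    (f + g).coeff t = f.coeff t + g.coeff t := rfl

@[simp] theorem coeff_sub (f g : PiretAlgebra σ) (t : ℕ) :
    (f - g).coeff t = f.coeff t - g.coeff t := Finsupp.sub_apply _ _ _

theorem coeff_monomial (j t : ℕ) (a : A) :
    (monomial σ j a).coeff t = if j = t then a else 0 := Finsupp.single_apply

@[simp] theorem coeff_monomial_self (j : ℕ) (a : A) : (monomial σ j a).coeff j = a := by
  simp [coeff_monomial]

theorem coeff_monomial_mul_add (j t : ℕ) (a : A) (f : PiretAlgebra σ) :
    (monomial σ j a * f).coeff (j + t) = (σ ^ t) a * f.coeff t := by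
  rw [coeff_mul, Finset.sum_eq_single (j, t)]
  · simp
  · rintro ⟨p, q⟩ hpq hne
    rw [Finset.HasAntidiagonal.mem_antidiagonal] at hpq
    have : j ≠ p := by
      rintro rfl
      exact hne (by rw [Nat.add_left_cancel (m := q) hpq])
    simp [coeff_monomial, this]
  · intro h
    simp at h

@[simp] theorem coeff_monomial_zero_mul (t : ℕ) (a : A) (f : PiretAlgebra σ) :
    (monomial σ 0 a * f).coeff t = (σ ^ t) a * f.coeff t := by
  simpa using coeff_monomial_mul_add 0 t a f

@[simp] theorem coeff_mul_monomial_zero (t : ℕ) (a : A) (f : PiretAlgebra σ) :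
    (f * monomial σ 0 a).coeff t = f.coeff t * a := by
  rw [coeff_mul, Finset.sum_eq_single (t, 0)]
  · simp
  · rintro ⟨p, q⟩ hpq hne
    rw [Finset.HasAntidiagonal.mem_antidiagonal] at hpq
    have : 0 ≠ q := by
      rintro rfl
      exact hne (by rw [← hpq, add_zero])
    simp [coeff_monomial, this]
  · intro h
    simp at h

theorem monomial_zero_mul_monomial_zero (a b : A) :
    monomial σ 0 a * monomial σ 0 b = monomial σ 0 (a * b) := by
  simp [monomial_mul_monomial]

theorem isUnit_monomial_zero {a : A} (ha : IsUnit a) : IsUnit (monomial σ 0 a) := by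
  obtain ⟨b, hb⟩ := isUnit_iff_exists.1 ha
  exact isUnit_iff_exists.2 ⟨monomial σ 0 b, by
    rw [monomial_zero_mul_monomial_zero, hb.1, one_def], by
    rw [monomial_zero_mul_monomial_zero, hb.2, one_def]⟩

/-- All coefficients of `f` beyond `N` vanish. -/
def DegreeLE (f : PiretAlgebra σ) (N : ℕ) : Prop := ∀ t, N < t → f.coeff t = 0

theorem exists_degreeLE (f : PiretAlgebra σ) : ∃ N, f.DegreeLE N := by
  induction f using induction_on with
  | h0 => exact ⟨0, fun _ _ => rfl⟩
  | hadd f g hf hg =>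
    obtain ⟨M, hM⟩ := hf
    obtain ⟨N, hN⟩ := hg
    refine ⟨max M N, fun t ht => ?_⟩
    rw [coeff_add, hM t (lt_of_le_of_lt (le_max_left _ _) ht),
      hN t (lt_of_le_of_lt (le_max_right _ _) ht), add_zero]
  | hm j a => exact ⟨j, fun t ht => by rw [coeff_monomial, if_neg ht.ne]⟩

theorem DegreeLE.exists_top {f : PiretAlgebra σ} {N : ℕ} (h : f.DegreeLE N) (hf : f ≠ 0) :
    ∃ M ≤ N, f.coeff M ≠ 0 ∧ f.DegreeLE M := by
  induction N with
  | zero =>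
    refine ⟨0, le_rfl, fun h0 => hf (ext fun t => ?_), h⟩
    rcases Nat.eq_zero_or_pos t with rfl | ht
    exacts [h0, h t ht]
  | succ N ih =>
    by_cases h0 : f.coeff (N + 1) = 0
    · obtain ⟨M, hM, h1⟩ := ih fun t ht => by
        rcases (Nat.succ_le_of_lt ht).eq_or_lt with rfl | h2
        exacts [h0, h t h2]
      exact ⟨M, hM.trans N.le_succ, h1⟩
    · exact ⟨N + 1, le_rfl, h0, h⟩

theorem exists_top {f : PiretAlgebra σ} (hf : f ≠ 0) : ∃ M, f.coeff M ≠ 0 ∧ f.DegreeLE M := by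
  obtain ⟨N, hN⟩ := f.exists_degreeLE
  obtain ⟨M, -, h⟩ := hN.exists_top hf
  exact ⟨M, h⟩

theorem DegreeLE.mul {f g : PiretAlgebra σ} {M N : ℕ} (hf : f.DegreeLE M) (hg : g.DegreeLE N) :
    (f * g).DegreeLE (M + N) := by
  intro t ht
  rw [coeff_mul]
  refine Finset.sum_eq_zero ?_
  rintro ⟨p, q⟩ hpq
  rw [Finset.HasAntidiagonal.mem_antidiagonal] at hpq
  dsimp only at hpq ⊢
  rcases lt_or_ge M p with h | h
  · rw [hf p h, map_zero, zero_mul]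
  · rw [hg q (by omega), mul_zero]

theorem DegreeLE.sub {f g : PiretAlgebra σ} {N : ℕ} (hf : f.DegreeLE N) (hg : g.DegreeLE N) :
    (f - g).DegreeLE N := fun t ht => by rw [coeff_sub, hf t ht, hg t ht, sub_zero]

theorem degreeLE_monomial (j : ℕ) (a : A) : (monomial σ j a).DegreeLE j :=
  fun t ht => by rw [coeff_monomial, if_neg ht.ne]

/-- Only the pair `(M, N)` can contribute in the top degree. The resulting product may still vanish,
because `A` has zero divisors. -/
theorem DegreeLE.coeff_mul_top {f g : PiretAlgebra σ} {M N : ℕ} (hf : f.DegreeLE M)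
    (hg : g.DegreeLE N) : (f * g).coeff (M + N) = (σ ^ N) (f.coeff M) * g.coeff N := by
  rw [coeff_mul, Finset.sum_eq_single (M, N)]
  · rintro ⟨p, q⟩ hpq hne
    rw [Finset.HasAntidiagonal.mem_antidiagonal] at hpq
    dsimp only at hpq ⊢
    rcases lt_trichotomy M p with h | rfl | h
    · rw [hf p h, map_zero, zero_mul]
    · exact absurd (by rw [Nat.add_left_cancel hpq]) hne
    · rw [hg q (by omega), mul_zero]
  · intro h
    simp at h

/-- Supplies the pigeonhole for remainders of bounded degree. -/
theorem finite_degreeLE [Finite A] (N : ℕ) : {f : PiretAlgebra σ | f.DegreeLE N}.Finite := by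
  refine Set.Finite.of_finite_image (f := fun f (t : Fin (N + 1)) => f.coeff t)
    (Set.toFinite _) ?_
  intro f hf g hg h
  ext t
  rcases lt_or_ge N t with ht | ht
  · rw [hf t ht, hg t ht]
  · exact congrFun h ⟨t, Nat.lt_succ_of_le ht⟩

/-! ### Leading terms, column reduction and division for components -/

section Idempotents

variable {r : ℕ} {e : Fin r → A}

theorem pow_apply_ne_zero {a : A} (t : ℕ) (ha : a ≠ 0) : (σ ^ t) a ≠ 0 :=
  (map_ne_zero_iff _ (σ ^ t).injective).2 ha

/-- The powers of `σ` permute the primitive idempotents. -/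
theorem exists_pow_apply_eq (he : CompleteOrthogonalIdempotents e)
    (hf : ∀ k, IsFieldIdempotent (e k)) (t : ℕ) (k : Fin r) : ∃ m, (σ ^ t) (e k) = e m := by
  -- The image is again a field idempotent, and by completeness it meets some `e m`; two field
  -- idempotents that meet are equal.
  obtain ⟨m, hm⟩ := he.exists_mul_ne_zero (pow_apply_ne_zero (σ := σ) t (hf k).ne_zero)
  exact ⟨m, ((hf m).eq_of_mul_ne_zero ((hf k).map (σ ^ t : A ≃ₐ[F] A).toRingEquiv) hm).symm⟩

theorem coeff_eq_of_mul_eq {a : A} {f : PiretAlgebra σ} (h : monomial σ 0 a * f = f) (t : ℕ) :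
    (σ ^ t) a * f.coeff t = f.coeff t := by
  rw [← coeff_monomial_zero_mul, h]

theorem coeff_eq_of_mul_eq' {a : A} {f : PiretAlgebra σ} (h : f * monomial σ 0 a = f) (t : ℕ) :
    a * f.coeff t = f.coeff t := by
  rw [mul_comm, ← coeff_mul_monomial_zero, h]

/-- The leading coefficient of `f ε_l g` is the product of the leading coefficients. -/
theorem coeff_mul_top_ne_zero (he : CompleteOrthogonalIdempotents e)
    (hf : ∀ k, IsFieldIdempotent (e k)) {l : Fin r} {f g : PiretAlgebra σ} {M N : ℕ}
    (hfl : f * monomial σ 0 (e l) = f) (hlg : monomial σ 0 (e l) * g = g)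
    (hfM : f.DegreeLE M) (hgN : g.DegreeLE N) (hfM' : f.coeff M ≠ 0) (hgN' : g.coeff N ≠ 0) :
    (f * g).coeff (M + N) ≠ 0 := by
  -- Both factors of the top coefficient, `(σ ^ N) (f.coeff M)` and `g.coeff N`, lie in the same
  -- field `e m A`.
  obtain ⟨m, hm⟩ := exists_pow_apply_eq (σ := σ) he hf N l
  have h1 := coeff_eq_of_mul_eq hlg N
  have h2 := congrArg (σ ^ N) (coeff_eq_of_mul_eq' hfl M)
  rw [hm] at h1
  rw [map_mul, hm] at h2
  rw [hfM.coeff_mul_top hgN, ← h2]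
  exact (hf m).mul_ne_zero (by rw [h2]; exact pow_apply_ne_zero N hfM') (by rwa [h1])

/-- Elementary column operations reduce a component to a multiple of a primitive idempotent. -/
theorem exists_unit_mul_eq (he : CompleteOrthogonalIdempotents e)
    (hf : ∀ k, IsFieldIdempotent (e k)) {l : Fin r} (N : ℕ) {g : PiretAlgebra σ} (hg : g ≠ 0)
    (hlg : monomial σ 0 (e l) * g = g) (hN : g.DegreeLE N) :
    ∃ (v : (PiretAlgebra σ)ˣ) (k : Fin r), g * v * monomial σ 0 (e k) = g * v := by
  induction N using Nat.strong_induction_on generalizing g with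
  | _ N ih =>
  obtain ⟨M, hMN, hM, hgM⟩ := hN.exists_top hg
  obtain ⟨m, hm⟩ := exists_pow_apply_eq (σ := σ) he hf M l
  by_cases hgm : g * monomial σ 0 (e m) = g
  · exact ⟨1, m, by simpa using hgm⟩
  obtain ⟨q, hqm, hq⟩ : ∃ q, q ≠ m ∧ g * monomial σ 0 (e q) ≠ 0 := by
    by_contra! h
    apply hgm
    calc g * monomial σ 0 (e m) = ∑ q, g * monomial σ 0 (e q) :=
          (Finset.sum_eq_single m (fun q _ => h q) (by simp)).symm
      _ = g := by rw [← Finset.mul_sum, ← map_sum, he.complete, ← one_def, mul_one]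
  have hgq : (g * monomial σ 0 (e q)).DegreeLE M := by
    simpa using hgM.mul (degreeLE_monomial 0 (e q))
  obtain ⟨ν, hνM, hν, hgν⟩ := hgq.exists_top hq
  have hgMm : e m * g.coeff M = g.coeff M := by rw [← hm, coeff_eq_of_mul_eq hlg]
  -- The top coefficient of `g` lies in `e m A`, so it is killed by `e q`.
  have hlt : ν < M := by
    refine lt_of_le_of_ne hνM ?_
    rintro rfl
    apply hν
    rw [coeff_mul_monomial_zero, ← hgMm, mul_right_comm, he.ortho hqm.symm, zero_mul]
  obtain ⟨j, rfl⟩ := Nat.exists_eq_add_of_lt hlt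
  -- `c` is the leading coefficient of `g ε_q` after right multiplication by `z^(j+1)`, which lifts
  -- its degree `ν` to that of `g`. It lands in the same field `e m A` and is invertible there.
  set c := (σ ^ (j + 1)) ((g * monomial σ 0 (e q)).coeff ν) with hc
  have hcm : e m * c = c := by
    have h1 : monomial σ 0 (e l) * (g * monomial σ 0 (e q)) = g * monomial σ 0 (e q) := by
      rw [← mul_assoc, hlg]
    have h2 := congrArg (σ ^ (j + 1)) (coeff_eq_of_mul_eq h1 ν)
    rw [map_mul, ← AlgEquiv.mul_apply, ← pow_add] at h2
    rw [← hm, hc, show ν + j + 1 = j + 1 + ν by omega]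
    exact h2
  obtain ⟨b, hb⟩ := (hf m).exists_mul_eq c (by rw [hcm]; exact pow_apply_ne_zero _ hν)
  rw [hcm] at hb
  -- Chosen so that `g ε_q w` has the same top term as `g`.
  set w := monomial σ (j + 1) (b * g.coeff (ν + j + 1)) with hw
  have hwm : w * monomial σ 0 (e m) = w := by
    rw [hw, monomial_mul_monomial]
    simp only [pow_zero, AlgEquiv.one_apply, add_zero]
    rw [mul_assoc, mul_comm _ (e m), hgMm]
  -- Since `w = w ε_m` and `q ≠ m`, `y` squares to zero. Thus `1 - y` is a unit with inverse `1 +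
  -- y`, and right multiplication by it cancels the top term of `g`.
  set y := monomial σ 0 (e q) * w with hy
  have hyy : y * y = 0 := by
    have : y * monomial σ 0 (e m) = y := by rw [hy, mul_assoc, hwm]
    calc y * y = y * (monomial σ 0 (e m) * monomial σ 0 (e q)) * w := by
          nth_rewrite 1 [← this]
          rw [hy]
          simp only [mul_assoc]
      _ = 0 := by
          rw [monomial_zero_mul_monomial_zero, he.ortho hqm.symm, map_zero, mul_zero, zero_mul]
  let u : (PiretAlgebra σ)ˣ :=
    ⟨1 - y, 1 + y, by rw [sub_mul, mul_add, mul_add, hyy]; simp,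
      by rw [add_mul, mul_sub, mul_sub, hyy]; simp⟩
  have hgy : g * u = g - g * monomial σ 0 (e q) * w := by
    rw [mul_assoc, ← hy]
    exact (mul_sub _ _ _).trans (by rw [mul_one])
  have hne : g * u ≠ 0 := by simpa using hg
  have hdeg : (g * u).DegreeLE (ν + j) := by
    intro t ht
    rcases (Nat.succ_le_of_lt ht).eq_or_lt with rfl | h2
    · rw [hgy, coeff_sub, Nat.succ_eq_add_one, add_assoc,
        hgν.coeff_mul_top (degreeLE_monomial (j + 1) _), ← hc, coeff_monomial_self,
        ← mul_assoc, mul_comm c, hb, ← add_assoc, hgMm, sub_self]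
    · rw [hgy]
      exact (hgM.sub (hgν.mul (degreeLE_monomial (j + 1) _))) t h2
  obtain ⟨v, k, hv⟩ := ih (ν + j) (by omega) hne (by rw [← mul_assoc, hlg]) hdeg
  exact ⟨u * v, k, by simpa [mul_assoc] using hv⟩

/-- Left division with remainder in `A[z;σ] ε_m`. -/
theorem exists_sub_mul_degreeLE {ε : A} (hε : IsFieldIdempotent ε) {h x : PiretAlgebra σ} {M : ℕ}
    (hh : h * monomial σ 0 ε = h) (hx : x * monomial σ 0 ε = x) (hM : h.DegreeLE M)
    (hM' : h.coeff M ≠ 0) (N : ℕ) (hN : x.DegreeLE (M + N)) :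
    ∃ q : PiretAlgebra σ, (x - q * h).DegreeLE M := by
  induction N generalizing x with
  | zero => exact ⟨0, by simpa using hN⟩
  | succ N ih =>
    have h1 := coeff_eq_of_mul_eq' hh M
    obtain ⟨b, hb⟩ := hε.exists_mul_eq (h.coeff M) (by rwa [h1])
    rw [h1] at hb
    -- The twist by `(σ ^ M).symm` is undone when the coefficient passes `z^M`, so `w * h` has the
    -- same top coefficient as `x`. The remainder is only brought down to degree at most `M`, not
    -- below it, which suffices for finiteness.
    set w := monomial σ (N + 1) ((σ ^ M).symm (x.coeff (M + (N + 1)) * b)) with hw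
    have hwh : (w * h).DegreeLE (M + (N + 1)) := by
      rw [add_comm M]
      exact (degreeLE_monomial _ _).mul hM
    have htop : (w * h).coeff (M + (N + 1)) = x.coeff (M + (N + 1)) := by
      rw [add_comm M, hw, (degreeLE_monomial _ _).coeff_mul_top hM, coeff_monomial_self,
        AlgEquiv.apply_symm_apply, mul_assoc, hb, mul_comm, add_comm (N + 1),
        coeff_eq_of_mul_eq' hx]
    obtain ⟨q, hq⟩ := ih (x := x - w * h) (by rw [sub_mul, mul_assoc, hh, hx]) (by
      intro t ht
      rcases (Nat.succ_le_of_lt ht).eq_or_lt with rfl | h2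
      · rw [coeff_sub]
        exact sub_eq_zero.2 htop.symm
      · exact (hN.sub hwh) t h2)
    exact ⟨w + q, by rwa [add_mul, ← sub_sub]⟩

/-- Any two nonzero left ideals in `A[z;σ] ε_m` have the same rank over `F[z]`. -/
theorem exists_sub_mul_eq_mul [Finite A] {ε : A} (hε : IsFieldIdempotent ε)
    {h x : PiretAlgebra σ} (h0 : h ≠ 0)
    (hh : h * monomial σ 0 ε = h) (hx : x * monomial σ 0 ε = x) :
    ∃ i j : ℕ, i < j ∧ ∃ q, (monomial σ j 1 - monomial σ i 1) * x = q * h := by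
  obtain ⟨M, hM', hM⟩ := exists_top h0
  have hdiv : ∀ i : ℕ, ∃ q : PiretAlgebra σ, (monomial σ i 1 * x - q * h).DegreeLE M := by
    intro i
    obtain ⟨N, hN⟩ := (monomial σ i 1 * x).exists_degreeLE
    exact exists_sub_mul_degreeLE hε hh (by rw [mul_assoc, hx]) hM hM' N
      fun t ht => hN t (by omega)
  choose q hq using hdiv
  have := (finite_degreeLE (σ := σ) M).to_subtype
  -- Two powers `z^i x` and `z^j x` leave the same remainder; subtracting gives the relation.
  obtain ⟨i, j, hij, heq⟩ := Finite.exists_ne_map_eq_of_infinite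
    fun i : ℕ => (⟨_, hq i⟩ : {f : PiretAlgebra σ | f.DegreeLE M})
  have heq' := congrArg Subtype.val heq
  dsimp only at heq'
  rcases lt_or_gt_of_ne hij with hlt | hlt
  · refine ⟨i, j, hlt, q j - q i, ?_⟩
    rw [sub_mul, sub_mul, sub_eq_sub_iff_add_eq_add]
    rw [sub_eq_sub_iff_add_eq_add] at heq'
    rw [← heq', add_comm]
  · refine ⟨j, i, hlt, q i - q j, ?_⟩
    rw [sub_mul, sub_mul, sub_eq_sub_iff_add_eq_add]
    rw [sub_eq_sub_iff_add_eq_add] at heq'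
    rw [heq', add_comm]

end Idempotents

end PiretAlgebra

/-! ### The map `𝔭` as an isomorphism of `F[z]`-modules, and saturated submodules -/

section Concrete

variable {F : Type*} [Field F] {n r : ℕ}

namespace OrderedFactorization

variable (π : OrderedFactorization F n r)

theorem completeOrthogonalIdempotents_idem : CompleteOrthogonalIdempotents π.idem := by
  have : π.idem = π.crt.symm.toRingHom ∘ (Pi.single · 1) := rfl
  rw [this]
  exact (CompleteOrthogonalIdempotents.single fun k => AdjoinRoot (π.factor k)).map _

theorem isFieldIdempotent_idem (k : Fin r) : IsFieldIdempotent (π.idem k) := by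
  have := Fact.mk (π.irreducible k)
  exact (IsFieldIdempotent.pi_single (K := fun k => AdjoinRoot (π.factor k))
    (Field.toIsField (AdjoinRoot (π.factor k)))).map π.crt.symm

end OrderedFactorization

theorem finite_cyclicAlg [Finite F] (hn : n ≠ 0) : Finite (CyclicAlg F n) := by
  have hm : (X ^ n - 1 : F[X]).Monic := by simpa using monic_X_pow_sub_C (1 : F) hn
  have := hm.finite_adjoinRoot
  exact Module.finite_of_finite F

variable (σ : CyclicAlg F n ≃ₐ[F] CyclicAlg F n)

theorem toPiret_add (v w : Fin n → F[X]) : toPiret σ (v + w) = toPiret σ v + toPiret σ w := by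
  rw [toPiret, toPiret, toPiret, ← Finset.sum_add_distrib]
  refine Finset.sum_congr rfl fun i _ => ?_
  rw [Pi.add_apply]
  exact sum_add_index _ _ _ (fun j => by rw [zero_smul, map_zero]) fun j a b => by rw [add_smul, map_add]

/-- The map `𝔭` as an additive homomorphism. -/
def toPiretHom : (Fin n → F[X]) →+ PiretAlgebra σ := AddMonoidHom.mk' (toPiret σ) (toPiret_add σ)

theorem toPiret_zero : toPiret σ 0 = 0 := (toPiretHom σ).map_zero

/-- The embedding `F[z] → A[z;σ]`. -/
def ofPoly : F[X] →+ PiretAlgebra σ where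
  toFun p := p.sum fun j c => PiretAlgebra.monomial σ j (algebraMap F (CyclicAlg F n) c)
  map_zero' := by simp
  map_add' p q := sum_add_index _ _ _ (fun j => by rw [map_zero, map_zero]) fun j a b => by simp

theorem ofPoly_monomial (j : ℕ) (c : F) :
    ofPoly σ (monomial j c) = PiretAlgebra.monomial σ j (algebraMap F (CyclicAlg F n) c) :=
  sum_monomial_index c (fun j c => PiretAlgebra.monomial σ j (algebraMap F (CyclicAlg F n) c))
    (by rw [map_zero, map_zero])

theorem ofPoly_X_pow (j : ℕ) : ofPoly σ (X ^ j) = PiretAlgebra.monomial σ j 1 := by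
  simpa [monomial_one_right_eq_X_pow] using ofPoly_monomial σ j 1

/-- `σ` fixes the scalars in `F`, so the action of `F[z]` becomes left multiplication in `A[z;σ]`.
-/
theorem toPiret_smul (p : F[X]) (v : Fin n → F[X]) :
    toPiret σ (p • v) = ofPoly σ p * toPiret σ v := by
  rw [toPiret, toPiret, Finset.mul_sum]
  refine Finset.sum_congr rfl fun i _ => ?_
  rw [Pi.smul_apply, smul_eq_mul]
  generalize v i = q
  let a : F[X] →+ PiretAlgebra σ :=
    { toFun := fun q => q.sum fun j c =>
        PiretAlgebra.monomial σ j (c • AdjoinRoot.root (X ^ n - 1 : F[X]) ^ (i : ℕ))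
      map_zero' := by simp
      map_add' := fun p q => sum_add_index _ _ _ (fun j => by rw [zero_smul, map_zero])
        fun j a b => by rw [add_smul, map_add] }
  change a (p * q) = ofPoly σ p * a q
  have ha : ∀ j c, a (monomial j c) = PiretAlgebra.monomial σ j
      (c • AdjoinRoot.root (X ^ n - 1 : F[X]) ^ (i : ℕ)) :=
    fun j c => sum_monomial_index c (fun j c => PiretAlgebra.monomial σ j
      (c • AdjoinRoot.root (X ^ n - 1 : F[X]) ^ (i : ℕ))) (by rw [zero_smul, map_zero])
  induction p using Polynomial.induction_on' with
  | add p₁ p₂ h₁ h₂ => rw [add_mul, map_add, map_add, h₁, h₂, add_mul]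
  | monomial j c =>
    induction q using Polynomial.induction_on' with
    | add q₁ q₂ h₁ h₂ => rw [mul_add, map_add, map_add, h₁, h₂, mul_add]
    | monomial l d =>
      rw [monomial_mul_monomial, ha, ha, ofPoly_monomial, PiretAlgebra.monomial_mul_monomial,
        AlgEquiv.commutes, ← Algebra.smul_def, smul_smul]

theorem coeff_toPiret (v : Fin n → F[X]) (t : ℕ) :
    (toPiret σ v).coeff t =
      ∑ i : Fin n, (v i).coeff t • AdjoinRoot.root (X ^ n - 1 : F[X]) ^ (i : ℕ) := by
  let c : PiretAlgebra σ →+ CyclicAlg F n :=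
    { toFun := fun f => f.coeff t, map_zero' := rfl, map_add' := fun _ _ => rfl }
  change c (toPiret σ v) = _
  rw [toPiret, map_sum]
  refine Finset.sum_congr rfl fun i _ => ?_
  rw [Polynomial.sum, map_sum]
  change ∑ j ∈ _, (PiretAlgebra.monomial σ j _).coeff t = _
  simp +contextual [PiretAlgebra.coeff_monomial]

/-- The basis `1, x, …, x^{n-1}` of `A`. -/
theorem exists_basis_root_pow (hn : n ≠ 0) :
    ∃ b : Module.Basis (Fin n) F (CyclicAlg F n),
      ∀ i, b i = AdjoinRoot.root (X ^ n - 1 : F[X]) ^ (i : ℕ) := by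
  have hm : (X ^ n - 1 : F[X]).Monic := by simpa using monic_X_pow_sub_C (1 : F) hn
  have hd : (X ^ n - 1 : F[X]).natDegree = n := by
    simpa using natDegree_X_pow_sub_C (n := n) (r := (1 : F))
  refine ⟨(AdjoinRoot.powerBasis' hm).basis.reindex (finCongr hd), fun i => ?_⟩
  rw [Module.Basis.reindex_apply, PowerBasis.basis_eq_pow]
  rfl

theorem toPiret_injective (hn : n ≠ 0) : Function.Injective (toPiret σ) := by
  refine (injective_iff_map_eq_zero (toPiretHom σ)).2 fun v hv => ?_
  obtain ⟨b, hb⟩ := exists_basis_root_pow (F := F) hn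
  ext i t
  have h : (toPiret σ v).coeff t = 0 := by
    change ((toPiretHom σ) v).coeff t = 0
    rw [hv, PiretAlgebra.coeff_zero]
  simp_rw [coeff_toPiret, ← hb] at h
  exact Fintype.linearIndependent_iff.1 b.linearIndependent _ h i

theorem toPiret_surjective (hn : n ≠ 0) : Function.Surjective (toPiret σ) := by
  obtain ⟨b, hb⟩ := exists_basis_root_pow (F := F) hn
  intro f
  induction f using PiretAlgebra.induction_on with
  | h0 => exact ⟨0, toPiret_zero σ⟩
  | hadd f g hf hg =>
    obtain ⟨v, rfl⟩ := hf
    obtain ⟨w, rfl⟩ := hg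
    exact ⟨v + w, toPiret_add σ v w⟩
  | hm j a =>
    refine ⟨fun i => monomial j (b.repr a i), PiretAlgebra.ext fun t => ?_⟩
    rw [coeff_toPiret, PiretAlgebra.coeff_monomial]
    simp_rw [coeff_monomial]
    split_ifs with h
    · simp_rw [← hb]
      exact b.sum_repr a
    · simp

/-- The quotient is finitely generated and torsion-free over a principal ideal domain, hence
projective, so the quotient map splits. -/
theorem isComplemented_of_smul_mem {R M : Type*} [CommRing R] [IsDomain R]
    [IsPrincipalIdealRing R] [AddCommGroup M] [Module R M] [Module.Finite R M]
    {N : Submodule R M} (h : ∀ (p : R) (x : M), p ≠ 0 → p • x ∈ N → x ∈ N) :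
    IsComplemented N := by
  have : Module.IsTorsionFree R (M ⧸ N) := by
    refine Module.isTorsionFree_iff_smul_eq_zero.2 fun p x hx => ?_
    obtain ⟨x, rfl⟩ := N.mkQ_surjective x
    rw [← map_smul, Submodule.mkQ_apply, Submodule.Quotient.mk_eq_zero] at hx
    rw [Submodule.mkQ_apply, Submodule.Quotient.mk_eq_zero]
    exact or_iff_not_imp_left.2 fun hp => h p x hp hx
  obtain ⟨s, hs⟩ := Module.projective_lifting_property N.mkQ LinearMap.id N.mkQ_surjective
  have hs' : ∀ y, N.mkQ (s y) = y := fun y => LinearMap.congr_fun hs y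
  have hN : ∀ x, (LinearMap.id - s ∘ₗ N.mkQ : M →ₗ[R] M) x ∈ N := fun x => by
    rw [← Submodule.Quotient.mk_eq_zero, ← Submodule.mkQ_apply, LinearMap.sub_apply, map_sub,
      LinearMap.id_apply, LinearMap.comp_apply, hs', sub_self]
  refine ⟨_, LinearMap.isCompl_of_proj
    (f := (LinearMap.id - s ∘ₗ N.mkQ).codRestrict N hN) fun x => Subtype.ext ?_⟩
  have : N.mkQ (x : M) = 0 := by simp
  simp [this]

/-- The part of `x` in the complement is annihilated by `p`, hence zero. This is how nonzero
polynomial factors are cancelled in codes. -/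
theorem _root_.IsComplemented.mem_of_smul_mem {R M : Type*} [CommRing R] [IsDomain R]
    [AddCommGroup M] [Module R M] [Module.IsTorsionFree R M]
    {N : Submodule R M} (h : IsComplemented N) {p : R} (hp : p ≠ 0) {x : M} (hx : p • x ∈ N) :
    x ∈ N := by
  obtain ⟨D, hD⟩ := h
  obtain ⟨a, ha, d, hd, rfl⟩ := Submodule.mem_sup.1 (hD.sup_eq_top ▸ Submodule.mem_top : x ∈ N ⊔ D)
  have hpd : p • d ∈ N := by simpa [smul_add] using N.sub_mem hx (N.smul_mem p ha)
  have h0 := Submodule.disjoint_def.1 hD.disjoint _ hpd (D.smul_mem p hd)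
  rw [(smul_eq_zero.1 h0).resolve_left hp, add_zero]
  exact ha

end Concrete

/-! ### Reduced generators and minimal codes -/

section Minimal

variable {F : Type*} [Field F] {n r : ℕ} (π : OrderedFactorization F n r)
  {σ : CyclicAlg F n ≃ₐ[F] CyclicAlg F n}

theorem component_component (k : Fin r) (f : PiretAlgebra σ) :
    component π k (component π k f) = component π k f := by
  rw [component, component, ← mul_assoc, PiretAlgebra.monomial_zero_mul_monomial_zero,
    (π.isFieldIdempotent_idem k).mul_self]

theorem sum_component (f : PiretAlgebra σ) : ∑ k, component π k f = f := by
  simp_rw [component]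
  rw [← Finset.sum_mul, ← map_sum, π.completeOrthogonalIdempotents_idem.complete,
    ← PiretAlgebra.one_def, one_mul]

theorem isLeadingMonomial_of_degreeLE {f : PiretAlgebra σ} {N : ℕ} {m : Fin r}
    (hN : f.DegreeLE N) (h0 : f.coeff N ≠ 0) (hm : π.idem m * f.coeff N = f.coeff N) :
    IsLeadingMonomial π f N m := by
  refine ⟨by rwa [hm], fun ν q h => ?_⟩
  rcases lt_trichotomy ν N with h1 | rfl | h1
  · exact Or.inl h1
  · refine Or.inr ⟨rfl, le_of_eq ?_⟩
    by_contra hq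
    rw [← hm, ← mul_assoc, π.completeOrthogonalIdempotents_idem.ortho hq, zero_mul] at h
    exact h rfl
  · rw [hN ν h1, mul_zero] at h
    exact absurd rfl h

/-- If `N ≥ M`, the term of `g^(k)` in degree `N` would be a left multiple of the leading monomial
`z^M ε_m` of `g^(l)`. Applied in both directions, this forbids equal idempotents in the leading
monomials of two different components. -/
theorem IsReduced.lt_of_coeff {g : PiretAlgebra σ} (hg : IsReduced π g) {k l m : Fin r}
    (hkl : k ≠ l) {M N : ℕ} (hM : (component π l g).DegreeLE M)
    (hM0 : (component π l g).coeff M ≠ 0)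
    (hMm : π.idem m * (component π l g).coeff M = (component π l g).coeff M)
    (hN0 : (component π k g).coeff N ≠ 0)
    (hNm : π.idem m * (component π k g).coeff N = (component π k g).coeff N) : N < M := by
  by_contra! h
  obtain ⟨j, rfl⟩ := Nat.exists_eq_add_of_le' h
  refine hg k l hkl M m (isLeadingMonomial_of_degreeLE π hM hM0 hMm) (j + M) m ?_
    ⟨PiretAlgebra.monomial σ j ((σ ^ M).symm ((component π k g).coeff (j + M))), ?_⟩
  · rw [term, hNm]
    intro h0
    apply hN0
    simpa using congrArg (fun f => PiretAlgebra.coeff f (j + M)) h0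
  · rw [term, PiretAlgebra.monomial_mul_monomial, AlgEquiv.apply_symm_apply, mul_comm]

/-- Different components of a reduced polynomial are linearly independent from the left, in the
sense that a nonzero `F[z]`-multiple `(z^j - z^i) g^{(k)}` is no multiple of `g^{(l)}`. -/
theorem IsReduced.sub_mul_component_ne {g : PiretAlgebra σ} (hg : IsReduced π g) {k l : Fin r}
    (hkl : k ≠ l) (hk : component π k g ≠ 0) (hl : component π l g ≠ 0) {i j : ℕ} (hij : i < j)
    (q : PiretAlgebra σ) :
    (PiretAlgebra.monomial σ j 1 - PiretAlgebra.monomial σ i 1) * component π k g ≠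
      q * component π l g := by
  intro h
  have he := π.completeOrthogonalIdempotents_idem
  have hf := π.isFieldIdempotent_idem
  obtain ⟨N, hN0, hN⟩ := PiretAlgebra.exists_top hk
  obtain ⟨M, hM0, hM⟩ := PiretAlgebra.exists_top hl
  have hkc : PiretAlgebra.monomial σ 0 (π.idem k) * component π k g = component π k g :=
    component_component π k g
  have hlc : PiretAlgebra.monomial σ 0 (π.idem l) * component π l g = component π l g :=
    component_component π l g
  obtain ⟨m, hm⟩ := PiretAlgebra.exists_pow_apply_eq (σ := σ) he hf N k
  obtain ⟨m', hm'⟩ := PiretAlgebra.exists_pow_apply_eq (σ := σ) he hf M l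
  have hNm := PiretAlgebra.coeff_eq_of_mul_eq hkc N
  rw [hm] at hNm
  have hMm := PiretAlgebra.coeff_eq_of_mul_eq hlc M
  rw [hm'] at hMm
  have hz : (PiretAlgebra.monomial σ j 1 - PiretAlgebra.monomial σ i 1 :
      PiretAlgebra σ).DegreeLE j :=
    (PiretAlgebra.degreeLE_monomial j 1).sub fun t ht =>
      PiretAlgebra.degreeLE_monomial i 1 t (hij.trans ht)
  have hL := hz.mul hN
  have hL0 := hz.coeff_mul_top hN
  rw [PiretAlgebra.coeff_sub, PiretAlgebra.coeff_monomial_self, PiretAlgebra.coeff_monomial,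
    if_neg hij.ne, sub_zero, map_one (σ ^ N), one_mul] at hL0
  -- Replacing `q` by `q ε_l` leaves the product unchanged and makes degrees add.
  set x := q * PiretAlgebra.monomial σ 0 (π.idem l) with hx
  have hxl : x * PiretAlgebra.monomial σ 0 (π.idem l) = x := by
    rw [hx, mul_assoc, PiretAlgebra.monomial_zero_mul_monomial_zero, (hf l).mul_self]
  have hxg : q * component π l g = x * component π l g := by rw [hx, mul_assoc, hlc]
  rw [hxg] at h
  have hx0 : x ≠ 0 := by
    intro hx0
    rw [h, hx0, zero_mul] at hL0
    exact hN0 hL0.symm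
  obtain ⟨P, hP0, hP⟩ := PiretAlgebra.exists_top hx0
  have hR := hP.mul hM
  have hR0 := PiretAlgebra.coeff_mul_top_ne_zero he hf hxl hlc hP hM hP0 hM0
  rw [h] at hL hL0
  have hdeg : j + N = P + M := by
    rcases lt_trichotomy (j + N) (P + M) with h1 | h1 | h1
    · exact absurd (hL _ h1) hR0
    · exact h1
    · rw [hR _ h1] at hL0
      exact absurd hL0.symm hN0
  -- The common top coefficient of the two sides is nonzero and lies in both `ε_m A` and `ε_m' A`.
  have hmm : m = m' := by
    by_contra hne
    apply hN0
    rw [← hNm, ← hL0, hdeg, hP.coeff_mul_top hM, ← hMm, mul_left_comm, ← mul_assoc (π.idem m),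
      he.ortho hne, zero_mul, mul_zero]
  subst hmm
  exact lt_asymm (hg.lt_of_coeff π hkl hM hM0 hMm hN0 hNm)
    (hg.lt_of_coeff π hkl.symm hN hN0 hNm hM0 hMm)

variable {π} {C : Submodule F[X] (Fin n → F[X])} {g : PiretAlgebra σ}

theorem IsGeneratorPolynomial.mem_iff (hn : n ≠ 0) (hg : IsGeneratorPolynomial π C g)
    (v : Fin n → F[X]) : v ∈ C ↔ ∃ f, f * g = toPiret σ v := by
  rw [← Ideal.mem_span_singleton', ← SetLike.mem_coe (p := Ideal.span {g}), hg.2]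
  exact ((toPiret_injective σ hn).mem_set_image).symm

theorem IsGeneratorPolynomial.ne_bot_iff (hn : n ≠ 0) (hg : IsGeneratorPolynomial π C g) :
    C ≠ ⊥ ↔ g ≠ 0 := by
  rw [not_iff_not]
  obtain ⟨w, rfl⟩ := toPiret_surjective σ hn g
  constructor
  · rintro rfl
    have := (hg.mem_iff hn w).2 ⟨1, one_mul _⟩
    rw [(Submodule.mem_bot _).1 this, toPiret_zero]
  · intro h
    rw [eq_bot_iff]
    intro v hv
    obtain ⟨f, hf⟩ := (hg.mem_iff hn v).1 hv
    rw [h, mul_zero, ← toPiret_zero σ] at hf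
    exact (toPiret_injective σ hn hf).symm

theorem toPiret_sub_smul (i j : ℕ) (v : Fin n → F[X]) :
    toPiret σ ((X ^ j - X ^ i : F[X]) • v) =
      (PiretAlgebra.monomial σ j 1 - PiretAlgebra.monomial σ i 1) * toPiret σ v := by
  rw [toPiret_smul, map_sub, ofPoly_X_pow, ofPoly_X_pow]

theorem X_pow_sub_X_pow_ne_zero {i j : ℕ} (h : i < j) : (X ^ j - X ^ i : F[X]) ≠ 0 := by
  intro h0
  simpa [coeff_X_pow, h.ne'] using congrArg (fun p => Polynomial.coeff p j) h0

/-- If `g` is a component, every nonzero left ideal in `A[z;σ] g` has full rank. -/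
theorem IsMinimalCode.eq_of_le [Finite F] (hn : n ≠ 0) (hg : IsGeneratorPolynomial π C g)
    (hmin : IsMinimalCode π C g) {C' : Submodule F[X] (Fin n → F[X])}
    (hC' : IsSigmaCyclicCode σ C') (h0 : C' ≠ ⊥) (hle : C' ≤ C) : C' = C := by
  have := finite_cyclicAlg (F := F) hn
  obtain ⟨l, hl⟩ := hmin.2
  rw [component] at hl
  have hf := π.isFieldIdempotent_idem l
  obtain ⟨I, hI⟩ := hC'.2
  have hmem : ∀ v, v ∈ C' ↔ toPiret σ v ∈ I := fun v => by
    rw [← SetLike.mem_coe (p := I), hI]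
    exact ((toPiret_injective σ hn).mem_set_image).symm
  obtain ⟨v, hv, hv0⟩ := C'.ne_bot_iff.1 h0
  obtain ⟨h, hh⟩ := (hg.mem_iff hn v).1 (hle hv)
  refine le_antisymm hle fun w hw => ?_
  obtain ⟨x, hx⟩ := (hg.mem_iff hn w).1 hw
  have hεε : ∀ y : PiretAlgebra σ, y * PiretAlgebra.monomial σ 0 (π.idem l) *
      PiretAlgebra.monomial σ 0 (π.idem l) = y * PiretAlgebra.monomial σ 0 (π.idem l) := fun y => by
    rw [mul_assoc, PiretAlgebra.monomial_zero_mul_monomial_zero, hf.mul_self]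
  have hεg : ∀ y : PiretAlgebra σ, y * PiretAlgebra.monomial σ 0 (π.idem l) * g = y * g :=
    fun y => by rw [mul_assoc, ← hl]
  -- As `g = ε_l g`, left factors of `g` matter only through their products with `ε_l`, so the rank
  -- one argument applies to them in `A[z;σ] ε_l`.
  obtain ⟨i, j, hij, q, hq⟩ := PiretAlgebra.exists_sub_mul_eq_mul hf
    (h := h * PiretAlgebra.monomial σ 0 (π.idem l))
    (x := x * PiretAlgebra.monomial σ 0 (π.idem l)) (by
      intro h1
      apply hv0
      apply toPiret_injective σ hn
      rw [toPiret_zero, ← hh, ← hεg, h1, zero_mul]) (hεε h) (hεε x)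
  refine ((isConvolutionalCode_iff_isComplemented C').1 hC'.1).mem_of_smul_mem
    (X_pow_sub_X_pow_ne_zero hij) ((hmem _).2 ?_)
  rw [toPiret_sub_smul, ← hx, ← hεg x, ← mul_assoc, hq, mul_assoc, hεg, hh]
  exact I.mul_mem_left q ((hmem v).1 hv)

/-- The elements of a code annihilated from the right by `b` form a code. -/
theorem IsSigmaCyclicCode.exists_annihilated (hn : n ≠ 0) (hC : IsSigmaCyclicCode σ C)
    (b : PiretAlgebra σ) :
    ∃ C', IsSigmaCyclicCode σ C' ∧ C' ≤ C ∧ ∀ v, v ∈ C' ↔ v ∈ C ∧ toPiret σ v * b = 0 := by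
  let C' : Submodule F[X] (Fin n → F[X]) :=
    { carrier := {v | v ∈ C ∧ toPiret σ v * b = 0}
      zero_mem' := ⟨C.zero_mem, by rw [toPiret_zero, zero_mul]⟩
      add_mem' := fun {v w} hv hw => ⟨C.add_mem hv.1 hw.1, by
        rw [toPiret_add, add_mul, hv.2, hw.2, add_zero]⟩
      smul_mem' := fun p v hv => ⟨C.smul_mem p hv.1, by
        rw [toPiret_smul, mul_assoc, hv.2, mul_zero]⟩ }
  refine ⟨C', ⟨(isConvolutionalCode_iff_isComplemented C').2 ?_, ?_⟩, fun v hv => hv.1,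
    fun v => Iff.rfl⟩
  · refine isComplemented_of_smul_mem fun p v hp hv =>
      ⟨((isConvolutionalCode_iff_isComplemented C).1 hC.1).mem_of_smul_mem hp hv.1, ?_⟩
    -- Pulling `𝔭(v) b` back to `F[z]^n` makes torsion-freeness available to cancel `p`.
    obtain ⟨w, hw⟩ := toPiret_surjective σ hn (toPiret σ v * b)
    have h1 : toPiret σ (p • w) = toPiret σ 0 := by
      rw [toPiret_smul, hw, ← mul_assoc, ← toPiret_smul, hv.2, toPiret_zero]
    rw [← hw, (smul_eq_zero.1 (toPiret_injective σ hn h1)).resolve_left hp, toPiret_zero]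
  · obtain ⟨I, hI⟩ := hC.2
    -- Right multiplication by `b` is left linear, so its kernel is a left ideal.
    refine ⟨I ⊓ LinearMap.ker (LinearMap.toSpanSingleton (PiretAlgebra σ) (PiretAlgebra σ) b), ?_⟩
    ext f
    have hfI : f ∈ I ↔ ∃ v ∈ C, toPiret σ v = f := by
      rw [← SetLike.mem_coe (p := I), hI]
      rfl
    simp only [SetLike.mem_coe, Submodule.mem_inf, LinearMap.mem_ker,
      LinearMap.toSpanSingleton_apply, smul_eq_mul, hfI, Set.mem_image]
    constructor
    · rintro ⟨⟨v, hv, rfl⟩, h⟩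
      exact ⟨v, ⟨hv, h⟩, rfl⟩
    · rintro ⟨v, ⟨hv, h⟩, rfl⟩
      exact ⟨⟨v, hv, rfl⟩, h⟩

/-- A code without proper subcodes is generated by a component. -/
theorem isComponent_of_forall_eq [Finite F] (hn : n ≠ 0) (hC : IsSigmaCyclicCode σ C)
    (hg : IsGeneratorPolynomial π C g) (h0 : C ≠ ⊥)
    (hsub : ∀ C', IsSigmaCyclicCode σ C' → C' ≠ ⊥ → C' ≤ C → C' = C) : IsComponent π g := by
  have := finite_cyclicAlg (F := F) hn
  have he := π.completeOrthogonalIdempotents_idem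
  have hf := π.isFieldIdempotent_idem
  have hsum : ∑ l, component π l g ≠ 0 := by
    rw [sum_component π g]
    exact (hg.ne_bot_iff hn).1 h0
  obtain ⟨l, -, hl⟩ := Finset.exists_ne_zero_of_sum_ne_zero hsum
  refine ⟨l, ?_⟩
  conv_lhs => rw [← sum_component π g]
  refine Finset.sum_eq_single l (fun k _ hkl => ?_) (by simp)
  by_contra hk
  obtain ⟨N, hN⟩ := (component π l g).exists_degreeLE
  obtain ⟨v, m, hv⟩ := PiretAlgebra.exists_unit_mul_eq he hf N hl (component_component π l g) hN
  -- Being annihilated by `v (1 - ε_m)` means being moved into `A[z;σ] ε_m` by `v`. Unlike the left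
  -- ideal generated by `g^(l)`, this is visibly saturated.
  obtain ⟨C', hC', hle, hmem⟩ := hC.exists_annihilated hn
    (v * (1 - PiretAlgebra.monomial σ 0 (π.idem m)))
  obtain ⟨a, ha⟩ := toPiret_surjective σ hn (component π l g)
  have haC' : a ∈ C' := by
    refine (hmem a).2 ⟨(hg.mem_iff hn a).2 ⟨_, ha.symm⟩, ?_⟩
    rw [ha, ← mul_assoc, mul_sub, mul_one, hv, sub_self]
  have hCC' := hsub C' hC' (by
    rintro rfl
    apply hl
    rw [← ha, (Submodule.mem_bot _).1 haC', toPiret_zero]) hle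
  obtain ⟨w, hw⟩ := toPiret_surjective σ hn g
  have hgv : g * v * PiretAlgebra.monomial σ 0 (π.idem m) = g * v := by
    have h1 := ((hmem w).1 (hCC' ▸ (hg.mem_iff hn w).2 ⟨1, by rw [hw, one_mul]⟩)).2
    rw [hw, ← mul_assoc, mul_sub, mul_one] at h1
    exact (sub_eq_zero.1 h1).symm
  obtain ⟨i, j, hij, q, hq⟩ := PiretAlgebra.exists_sub_mul_eq_mul (hf m)
    (h := component π l g * (v : PiretAlgebra σ)) (x := component π k g * (v : PiretAlgebra σ)) (by simpa using hl) hv (by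
      simp only [component, mul_assoc] at hgv ⊢
      rw [hgv])
  rw [← mul_assoc, ← mul_assoc, Units.mul_left_inj] at hq
  exact hg.1.sub_mul_component_ne π hkl hk hl hij q hq

/-- A component generating a direct summand is a component of a unit. -/
theorem IsMinimalCode.exists_unit [Finite F] (hn : n ≠ 0) (hC : IsSigmaCyclicCode σ C)
    (hg : IsGeneratorPolynomial π C g) (hmin : IsMinimalCode π C g) :
    ∃ (u : (PiretAlgebra σ)ˣ) (l : Fin r), g = component π l (u : PiretAlgebra σ) := by
  have := finite_cyclicAlg (F := F) hn
  have he := π.completeOrthogonalIdempotents_idem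
  have hf := π.isFieldIdempotent_idem
  have hg0 := (hg.ne_bot_iff hn).1 hmin.1
  obtain ⟨l, hl⟩ := hmin.2
  have hlg : PiretAlgebra.monomial σ 0 (π.idem l) * g = g := hl.symm
  obtain ⟨N, hN⟩ := g.exists_degreeLE
  obtain ⟨v, k, hv⟩ := PiretAlgebra.exists_unit_mul_eq he hf N hg0 hlg hN
  have hgv0 : g * v ≠ 0 := by simpa using hg0
  obtain ⟨i, j, hij, q, hq⟩ := PiretAlgebra.exists_sub_mul_eq_mul (hf k) hgv0 hv
    (x := PiretAlgebra.monomial σ 0 (π.idem k))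
    (by rw [PiretAlgebra.monomial_zero_mul_monomial_zero, (hf k).mul_self])
  -- `(z^j - z^i) ε_k v⁻¹ = q g` lies in `𝔭(C)`; saturation removes the factor.
  obtain ⟨f, hfk⟩ : ∃ f, f * (g * v) = PiretAlgebra.monomial σ 0 (π.idem k) := by
    obtain ⟨w, hw⟩ := toPiret_surjective σ hn
      (PiretAlgebra.monomial σ 0 (π.idem k) * (v⁻¹ : (PiretAlgebra σ)ˣ))
    have hwC : w ∈ C := by
      refine ((isConvolutionalCode_iff_isComplemented C).1 hC.1).mem_of_smul_mem
        (X_pow_sub_X_pow_ne_zero hij) ((hg.mem_iff hn _).2 ⟨q, ?_⟩)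
      rw [toPiret_sub_smul, hw, ← mul_assoc, hq, ← mul_assoc, Units.mul_inv_cancel_right]
    obtain ⟨f, hfw⟩ := (hg.mem_iff hn w).1 hwC
    exact ⟨f, by rw [← mul_assoc, hfw, hw, Units.inv_mul_cancel_right]⟩
  obtain ⟨M, hM0, hM⟩ := PiretAlgebra.exists_top hgv0
  have hlgv : PiretAlgebra.monomial σ 0 (π.idem l) * (g * v) = g * v := by rw [← mul_assoc, hlg]
  set x := f * PiretAlgebra.monomial σ 0 (π.idem l) with hx
  have hxl : x * PiretAlgebra.monomial σ 0 (π.idem l) = x := by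
    rw [hx, mul_assoc, PiretAlgebra.monomial_zero_mul_monomial_zero, (hf l).mul_self]
  have hxg : x * (g * v) = PiretAlgebra.monomial σ 0 (π.idem k) := by
    rw [hx, mul_assoc, hlgv, hfk]
  have hx0 : x ≠ 0 := by
    intro hx0
    rw [hx0, zero_mul] at hxg
    apply (hf k).ne_zero
    simpa using congrArg (fun f => PiretAlgebra.coeff f 0) hxg.symm
  obtain ⟨P, hP0, hP⟩ := PiretAlgebra.exists_top hx0
  have htop := PiretAlgebra.coeff_mul_top_ne_zero he hf hxl hlgv hP hM hP0 hM0
  rw [hxg, PiretAlgebra.coeff_monomial] at htop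
  -- The product `ε_k` is constant and degrees add, so both factors are constant.
  obtain rfl : M = 0 := by
    have : 0 = P + M := by
      by_contra h
      exact htop (if_neg h)
    omega
  set c := (g * v).coeff 0 with hc
  have hlc : π.idem l * c = c := by
    simpa using PiretAlgebra.coeff_eq_of_mul_eq hlgv 0
  have hgvc : g * v = PiretAlgebra.monomial σ 0 c := by
    ext t
    rw [PiretAlgebra.coeff_monomial]
    split_ifs with h
    · rw [← h]
    · exact hM t (Nat.pos_of_ne_zero fun h' => h h'.symm)
  obtain ⟨b, hb⟩ := (hf l).exists_mul_eq c (by rwa [hlc])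
  rw [hlc] at hb
  -- `c` is invertible in the field `ε_l A`; adding `1 - ε_l` fills the other factors with `1`
  -- without changing the `l`-th component.
  have hunit : IsUnit (c + (1 - π.idem l)) := by
    refine IsUnit.of_mul_eq_one (π.idem l * b + (1 - π.idem l)) ?_
    have h1 : π.idem l * π.idem l = π.idem l := (hf l).mul_self
    linear_combination π.idem l * hb - hlc + (2 - b) * h1
  obtain ⟨u, hu⟩ := PiretAlgebra.isUnit_monomial_zero (σ := σ) hunit
  refine ⟨u * v⁻¹, l, ?_⟩
  rw [component, Units.val_mul, hu, ← mul_assoc, PiretAlgebra.monomial_zero_mul_monomial_zero,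
    mul_add, hlc, mul_sub, mul_one, (hf l).mul_self, sub_self, add_zero, ← hgvc,
    Units.mul_inv_cancel_right]

end Minimal

end CyclicConv

end

theorem mainTheorem4 {F : Type*} [Field F] [Fintype F] {n r : ℕ}
    (hn : Nat.Coprime n (Fintype.card F))
    (π : CyclicConv.OrderedFactorization F n r)
    (σ : CyclicConv.CyclicAlg F n ≃ₐ[F] CyclicConv.CyclicAlg F n)
    (C : Submodule F[X] (Fin n → F[X])) (hC : CyclicConv.IsSigmaCyclicCode σ C)
    (g : CyclicConv.PiretAlgebra σ) (hg : CyclicConv.IsGeneratorPolynomial π C g) :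
    List.TFAE
      [CyclicConv.IsMinimalCode π C g,
        C ≠ ⊥ ∧ ∀ C' : Submodule F[X] (Fin n → F[X]),
          CyclicConv.IsSigmaCyclicCode σ C' → C' ≠ ⊥ → C' ≤ C → C' = C,
        ∃ (u : (CyclicConv.PiretAlgebra σ)ˣ) (l : Fin r),
          g = CyclicConv.component π l (u : CyclicConv.PiretAlgebra σ)] := by
  -- Coprimality of `0` with `|F|` would force `|F| = 1`.
  have hn0 : n ≠ 0 := by
    rintro rfl
    exact Fintype.one_lt_card.ne' ((Nat.coprime_zero_left _).1 hn)
  tfae_have 1 → 2 := fun h => ⟨h.1, fun C' hC' h0 hle => h.eq_of_le hn0 hg hC' h0 hle⟩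
  tfae_have 2 → 1 := fun h => ⟨h.1, CyclicConv.isComponent_of_forall_eq hn0 hC hg h.1 h.2⟩
  tfae_have 1 → 3 := fun h => h.exists_unit hn0 hC hg
  tfae_have 3 → 1 := by
    rintro ⟨u, l, hu⟩
    refine ⟨(hg.ne_bot_iff hn0).2 ?_, l, by rw [hu, CyclicConv.component_component]⟩
    intro h0
    rw [h0, CyclicConv.component, eq_comm, Units.mul_left_eq_zero] at hu
    apply (π.isFieldIdempotent_idem l).ne_zero
    simpa using congrArg (fun f => CyclicConv.PiretAlgebra.coeff f 0) hu
  tfae_finish
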